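/- Let $R$ be a prime ring (associative, not necessarily unital; i.e. for $a,b\in R$, $aRb=0$ implies $a=0$ or $b=0$) with center $Z(R)$. Let $Q_s(R)\supseteq R$ be its Martindale symmetric ring of quotients, and let $C$ be the extended centroid of $R$, i.e. the center of $Q_s(R)$, which is a field. For an additive subgroup $A$ of $R$ let $AC\subseteq Q_s(R)$ denote the $C$-subspace spanned by $A$; in particular $RC$ is a subring of $Q_s(R)$. Let $K$ be a noncentral Lie ideal of $R$, i.e. an additive subgroup $K\not\subseteq Z(R)$ with $ar-ra\in K$ for all $a\in K$, $r\in R$. Write $$\mathfrak{C}_{RC}(K)=\{x\in RC : ax=xa\ \ \forall a\in K\},\qquad \mathfrak{C}_{R}(K)=\{x\in R : ax=xa\ \ \forall a\in K\}.$$ Then the following hold: (i) $\mathfrak{C}_{RC}(K)=KC$ if and only if $\dim_C KC=2$; (ii) $\mathfrak{C}_{R}(K)=Z(R)$ if and only if $\dim_C KC>2$ (where $\dim_C KC$ may be infinite). -/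

import Mathlib

universe u

/-- A prime ring (associative, not necessarily unital): a nonzero ring in which `a R b = 0` forces
`a = 0` or `b = 0`. -/
class IsPrimeRing (R : Type u) [NonUnitalRing R] : Prop extends Nontrivial R where
  eq_zero_or_eq_zero : ∀ a b : R, (∀ r : R, a * r * b = 0) → a = 0 ∨ b = 0

/-- A Lie ideal of an associative ring: an additive subgroup `L` with `[L, R] ⊆ L`. -/
def IsLieIdeal {R : Type u} [NonUnitalRing R] (L : AddSubgroup R) : Prop :=
  ∀ a ∈ L, ∀ r : R, a * r - r * a ∈ L

namespace MartindaleSymm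

/-- Representatives of elements of the Martindale symmetric ring of quotients of `R`: a nonzero
two-sided ideal `I` of `R` with a right `R`-module map `I → R`, `x ↦ lmap x` (to be thought of as
`x ↦ q x`), and a left `R`-module map `I → R`, `x ↦ rmap x` (to be thought of as `x ↦ x q`), such
that `(x q) y = x (q y)` for `x, y ∈ I`. For convenience `lmap` and `rmap` are total functions, but
only their values on `I` are relevant, see `QRep.Rel`. -/
structure QRep (R : Type u) [NonUnitalRing R] where
  dom : TwoSidedIdeal R
  dom_ne_bot : dom ≠ ⊥
  lmap : R → R
  rmap : R → R
  lmap_add : ∀ x ∈ dom, ∀ y ∈ dom, lmap (x + y) = lmap x + lmap y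
  rmap_add : ∀ x ∈ dom, ∀ y ∈ dom, rmap (x + y) = rmap x + rmap y
  lmap_mul : ∀ x ∈ dom, ∀ s : R, lmap (x * s) = lmap x * s
  rmap_mul : ∀ x ∈ dom, ∀ s : R, rmap (s * x) = s * rmap x
  compat : ∀ x ∈ dom, ∀ y ∈ dom, rmap x * y = x * lmap y

variable {R : Type u} [NonUnitalRing R]

namespace QRep

/-- Two representatives are identified when they agree on a nonzero ideal contained in both
domains. -/
def Rel (p q : QRep R) : Prop :=
  ∃ J : TwoSidedIdeal R, J ≠ ⊥ ∧ J ≤ p.dom ∧ J ≤ q.dom ∧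
    ∀ x ∈ J, p.lmap x = q.lmap x ∧ p.rmap x = q.rmap x

theorem rel_refl (p : QRep R) : Rel p p :=
  ⟨p.dom, p.dom_ne_bot, le_rfl, le_rfl, fun _ _ => ⟨rfl, rfl⟩⟩

theorem rel_symm {p q : QRep R} : Rel p q → Rel q p := fun ⟨J, h0, h1, h2, h⟩ =>
  ⟨J, h0, h2, h1, fun x hx => ⟨(h x hx).1.symm, (h x hx).2.symm⟩⟩

theorem lmap_zero (p : QRep R) : p.lmap 0 = 0 := by
  simpa using p.lmap_add 0 p.dom.zero_mem 0 p.dom.zero_mem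

theorem rmap_zero (p : QRep R) : p.rmap 0 = 0 := by
  simpa using p.rmap_add 0 p.dom.zero_mem 0 p.dom.zero_mem

theorem lmap_neg (p : QRep R) {x : R} (hx : x ∈ p.dom) : p.lmap (-x) = -p.lmap x := by
  have h := p.lmap_add x hx (-x) (p.dom.neg_mem hx)
  rw [add_neg_cancel, p.lmap_zero] at h
  exact (neg_eq_of_add_eq_zero_right h.symm).symm

theorem rmap_neg (p : QRep R) {x : R} (hx : x ∈ p.dom) : p.rmap (-x) = -p.rmap x := by
  have h := p.rmap_add x hx (-x) (p.dom.neg_mem hx)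
  rw [add_neg_cancel, p.rmap_zero] at h
  exact (neg_eq_of_add_eq_zero_right h.symm).symm

/-- For ideals `I` and `J` in the domains of `p` and `q`, an ideal of elements
`x ∈ I ∩ J` with `q x ∈ I` and `x p ∈ J`; it contains all products `x y` with `x, y ∈ I ∩ J`. -/
def mulDom (p q : QRep R) (I J : TwoSidedIdeal R) (hI : I ≤ p.dom) (hJ : J ≤ q.dom) :
    TwoSidedIdeal R :=
  .mk' {x | (x ∈ I ∧ x ∈ J) ∧ (q.lmap x ∈ I ∧ ∀ s, q.lmap (s * x) ∈ I) ∧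
      (p.rmap x ∈ J ∧ ∀ s, p.rmap (x * s) ∈ J)}
    (by
      simp only [Set.mem_ofPred_eq, mul_zero, zero_mul, q.lmap_zero, p.rmap_zero]
      simp [I.zero_mem, J.zero_mem])
    (by
      rintro x y ⟨⟨h1, h2⟩, ⟨h3, h4⟩, h5, h6⟩ ⟨⟨k1, k2⟩, ⟨k3, k4⟩, k5, k6⟩
      refine ⟨⟨I.add_mem h1 k1, J.add_mem h2 k2⟩, ⟨?_, fun s => ?_⟩, ?_, fun s => ?_⟩
      · rw [q.lmap_add x (hJ h2) y (hJ k2)]; exact I.add_mem h3 k3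
      · rw [mul_add, q.lmap_add _ (hJ (J.mul_mem_left s x h2)) _ (hJ (J.mul_mem_left s y k2))]
        exact I.add_mem (h4 s) (k4 s)
      · rw [p.rmap_add x (hI h1) y (hI k1)]; exact J.add_mem h5 k5
      · rw [add_mul, p.rmap_add _ (hI (I.mul_mem_right x s h1)) _ (hI (I.mul_mem_right y s k1))]
        exact J.add_mem (h6 s) (k6 s))
    (by
      rintro x ⟨⟨h1, h2⟩, ⟨h3, h4⟩, h5, h6⟩
      refine ⟨⟨I.neg_mem h1, J.neg_mem h2⟩, ⟨?_, fun s => ?_⟩, ?_, fun s => ?_⟩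
      · rw [q.lmap_neg (hJ h2)]; exact I.neg_mem h3
      · rw [mul_neg, q.lmap_neg (hJ (J.mul_mem_left s x h2))]; exact I.neg_mem (h4 s)
      · rw [p.rmap_neg (hI h1)]; exact J.neg_mem h5
      · rw [neg_mul, p.rmap_neg (hI (I.mul_mem_right x s h1))]; exact J.neg_mem (h6 s))
    (by
      rintro u x ⟨⟨h1, h2⟩, ⟨h3, h4⟩, h5, h6⟩
      refine ⟨⟨I.mul_mem_left _ _ h1, J.mul_mem_left _ _ h2⟩, ⟨h4 u, fun s => ?_⟩, ?_,
        fun s => ?_⟩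
      · rw [← mul_assoc]; exact h4 _
      · rw [p.rmap_mul x (hI h1)]; exact J.mul_mem_left _ _ h5
      · rw [mul_assoc, p.rmap_mul _ (hI (I.mul_mem_right x s h1))]
        exact J.mul_mem_left _ _ (h6 s))
    (by
      rintro x u ⟨⟨h1, h2⟩, ⟨h3, h4⟩, h5, h6⟩
      refine ⟨⟨I.mul_mem_right _ _ h1, J.mul_mem_right _ _ h2⟩, ⟨?_, fun s => ?_⟩, h6 u,
        fun s => ?_⟩
      · rw [q.lmap_mul x (hJ h2)]; exact I.mul_mem_right _ _ h3
      · rw [← mul_assoc, q.lmap_mul _ (hJ (J.mul_mem_left s x h2))]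
        exact I.mul_mem_right _ _ (h4 s)
      · rw [mul_assoc]; exact h6 _)

theorem mem_mulDom {p q : QRep R} {I J : TwoSidedIdeal R} {hI : I ≤ p.dom} {hJ : J ≤ q.dom}
    {x : R} : x ∈ mulDom p q I J hI hJ ↔ (x ∈ I ∧ x ∈ J) ∧
      (q.lmap x ∈ I ∧ ∀ s, q.lmap (s * x) ∈ I) ∧ (p.rmap x ∈ J ∧ ∀ s, p.rmap (x * s) ∈ J) := by
  rw [mulDom, TwoSidedIdeal.mem_mk']; rfl

end QRep

theorem exists_mem_ne_zero {I : TwoSidedIdeal R} (hI : I ≠ ⊥) : ∃ x ∈ I, x ≠ 0 := by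
  by_contra! h
  exact hI (le_bot_iff.mp fun x hx => (TwoSidedIdeal.mem_bot R).mpr (h x hx))

theorem ne_bot_of_mem {I : TwoSidedIdeal R} {x : R} (hx : x ∈ I) (h0 : x ≠ 0) : I ≠ ⊥ := by
  rintro rfl
  exact h0 ((TwoSidedIdeal.mem_bot R).mp hx)

variable [IsPrimeRing R]

theorem exists_mul_mul_ne_zero {a b : R} (ha : a ≠ 0) (hb : b ≠ 0) : ∃ r : R, a * r * b ≠ 0 := by
  by_contra! h
  exact (IsPrimeRing.eq_zero_or_eq_zero a b h).elim ha hb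

theorem inf_ne_bot {I J : TwoSidedIdeal R} (hI : I ≠ ⊥) (hJ : J ≠ ⊥) : I ⊓ J ≠ ⊥ := by
  obtain ⟨a, ha, ha0⟩ := exists_mem_ne_zero hI
  obtain ⟨b, hb, hb0⟩ := exists_mem_ne_zero hJ
  obtain ⟨r, hr⟩ := exists_mul_mul_ne_zero ha0 hb0
  exact ne_bot_of_mem (x := a * r * b) ((TwoSidedIdeal.mem_inf R).mpr
    ⟨I.mul_mem_right _ _ (I.mul_mem_right _ _ ha), J.mul_mem_left _ _ hb⟩) hr

theorem top_ne_bot' : (⊤ : TwoSidedIdeal R) ≠ ⊥ := by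
  obtain ⟨x, hx⟩ := exists_ne (0 : R)
  exact ne_bot_of_mem (x := x) (TwoSidedIdeal.mem_top R) hx

namespace QRep

theorem rel_trans {p q s : QRep R} : Rel p q → Rel q s → Rel p s :=
  fun ⟨J, h0, h1, _, h⟩ ⟨J', h0', _, h2', h'⟩ =>
  ⟨J ⊓ J', inf_ne_bot h0 h0', inf_le_left.trans h1, inf_le_right.trans h2', fun x hx =>
    ⟨(h x (inf_le_left (a := J) hx)).1.trans (h' x (inf_le_right (a := J) hx)).1,
      (h x (inf_le_left (a := J) hx)).2.trans (h' x (inf_le_right (a := J) hx)).2⟩⟩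

instance setoid (R : Type u) [NonUnitalRing R] [IsPrimeRing R] : Setoid (QRep R) :=
  ⟨Rel, rel_refl, rel_symm, rel_trans⟩

/-- Equality of the maps on the intersection of the domains suffices. -/
theorem rel_of_eq {p q : QRep R} (h : ∀ x ∈ p.dom, x ∈ q.dom →
    p.lmap x = q.lmap x ∧ p.rmap x = q.rmap x) : p ≈ q :=
  ⟨p.dom ⊓ q.dom, inf_ne_bot p.dom_ne_bot q.dom_ne_bot, inf_le_left, inf_le_right,
    fun x hx => h x (inf_le_left (a := p.dom) hx) (inf_le_right (a := p.dom) hx)⟩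

/-- The class of an element `a` of `R`: the maps `x ↦ a x` and `x ↦ x a` on `R`. -/
def of (a : R) : QRep R where
  dom := ⊤
  dom_ne_bot := top_ne_bot'
  lmap x := a * x
  rmap x := x * a
  lmap_add x _ y _ := mul_add a x y
  rmap_add x _ y _ := add_mul x y a
  lmap_mul x _ s := (mul_assoc a x s).symm
  rmap_mul x _ s := mul_assoc s x a
  compat x _ y _ := mul_assoc x a y

/-- The unit element: the identity maps on `R`. -/
def one (R : Type u) [NonUnitalRing R] [IsPrimeRing R] : QRep R where
  dom := ⊤
  dom_ne_bot := top_ne_bot'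
  lmap x := x
  rmap x := x
  lmap_add _ _ _ _ := rfl
  rmap_add _ _ _ _ := rfl
  lmap_mul _ _ _ := rfl
  rmap_mul _ _ _ := rfl
  compat _ _ _ _ := rfl

/-- Addition of the maps, on the intersection of the domains. -/
def add (p q : QRep R) : QRep R where
  dom := p.dom ⊓ q.dom
  dom_ne_bot := inf_ne_bot p.dom_ne_bot q.dom_ne_bot
  lmap x := p.lmap x + q.lmap x
  rmap x := p.rmap x + q.rmap x
  lmap_add x hx y hy := by
    rw [TwoSidedIdeal.mem_inf] at hx hy
    rw [p.lmap_add x hx.1 y hy.1, q.lmap_add x hx.2 y hy.2, add_add_add_comm]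
  rmap_add x hx y hy := by
    rw [TwoSidedIdeal.mem_inf] at hx hy
    rw [p.rmap_add x hx.1 y hy.1, q.rmap_add x hx.2 y hy.2, add_add_add_comm]
  lmap_mul x hx s := by
    rw [TwoSidedIdeal.mem_inf] at hx
    rw [p.lmap_mul x hx.1, q.lmap_mul x hx.2, add_mul]
  rmap_mul x hx s := by
    rw [TwoSidedIdeal.mem_inf] at hx
    rw [p.rmap_mul x hx.1, q.rmap_mul x hx.2, mul_add]
  compat x hx y hy := by
    rw [TwoSidedIdeal.mem_inf] at hx hy
    rw [add_mul, mul_add, p.compat x hx.1 y hy.1, q.compat x hx.2 y hy.2]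

/-- Negation of the maps. -/
def neg (p : QRep R) : QRep R where
  dom := p.dom
  dom_ne_bot := p.dom_ne_bot
  lmap x := -p.lmap x
  rmap x := -p.rmap x
  lmap_add x hx y hy := by rw [p.lmap_add x hx y hy, neg_add]
  rmap_add x hx y hy := by rw [p.rmap_add x hx y hy, neg_add]
  lmap_mul x hx s := by rw [p.lmap_mul x hx, neg_mul]
  rmap_mul x hx s := by rw [p.rmap_mul x hx, mul_neg]
  compat x hx y hy := by rw [neg_mul, mul_neg, p.compat x hx y hy]

theorem mulDom_ne_bot (p q : QRep R) (I J : TwoSidedIdeal R) (hI : I ≤ p.dom) (hJ : J ≤ q.dom)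
    (hI0 : I ≠ ⊥) (hJ0 : J ≠ ⊥) : mulDom p q I J hI hJ ≠ ⊥ := by
  obtain ⟨x, hx, hx0⟩ := exists_mem_ne_zero (inf_ne_bot hI0 hJ0)
  rw [TwoSidedIdeal.mem_inf] at hx
  obtain ⟨r, hr⟩ := exists_mul_mul_ne_zero hx0 hx0
  have hxr : x * r ∈ I ∧ x * r ∈ J := ⟨I.mul_mem_right _ _ hx.1, J.mul_mem_right _ _ hx.2⟩
  refine ne_bot_of_mem (x := x * r * x) (mem_mulDom.mpr
    ⟨⟨I.mul_mem_left _ _ hx.1, J.mul_mem_left _ _ hx.2⟩, ⟨?_, fun s => ?_⟩, ?_, fun s => ?_⟩) hr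
  · rw [q.lmap_mul _ (hJ hxr.2)]; exact I.mul_mem_left _ _ hx.1
  · rw [← mul_assoc, q.lmap_mul _ (hJ (J.mul_mem_left _ _ hxr.2))]
    exact I.mul_mem_left _ _ hx.1
  · rw [p.rmap_mul _ (hI hx.1)]; exact J.mul_mem_right _ _ hxr.2
  · rw [mul_assoc, p.rmap_mul _ (hI (I.mul_mem_right _ _ hx.1))]
    exact J.mul_mem_right _ _ hxr.2

/-- Multiplication: `(p q) x = p (q x)` and `x (p q) = (x p) q`. -/
def mul (p q : QRep R) : QRep R where
  dom := mulDom p q p.dom q.dom le_rfl le_rfl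
  dom_ne_bot := mulDom_ne_bot _ _ _ _ _ _ p.dom_ne_bot q.dom_ne_bot
  lmap x := p.lmap (q.lmap x)
  rmap x := q.rmap (p.rmap x)
  lmap_add x hx y hy := by
    obtain ⟨⟨h1, h2⟩, ⟨h3, h4⟩, h5, h6⟩ := mem_mulDom.mp hx
    obtain ⟨⟨k1, k2⟩, ⟨k3, k4⟩, k5, k6⟩ := mem_mulDom.mp hy
    rw [q.lmap_add x h2 y k2, p.lmap_add _ h3 _ k3]
  rmap_add x hx y hy := by
    obtain ⟨⟨h1, h2⟩, ⟨h3, h4⟩, h5, h6⟩ := mem_mulDom.mp hx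
    obtain ⟨⟨k1, k2⟩, ⟨k3, k4⟩, k5, k6⟩ := mem_mulDom.mp hy
    rw [p.rmap_add x h1 y k1, q.rmap_add _ h5 _ k5]
  lmap_mul x hx s := by
    obtain ⟨⟨h1, h2⟩, ⟨h3, h4⟩, h5, h6⟩ := mem_mulDom.mp hx
    rw [q.lmap_mul x h2, p.lmap_mul _ h3]
  rmap_mul x hx s := by
    obtain ⟨⟨h1, h2⟩, ⟨h3, h4⟩, h5, h6⟩ := mem_mulDom.mp hx
    rw [p.rmap_mul x h1, q.rmap_mul _ h5]
  compat x hx y hy := by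
    obtain ⟨⟨h1, h2⟩, ⟨h3, h4⟩, h5, h6⟩ := mem_mulDom.mp hx
    obtain ⟨⟨k1, k2⟩, ⟨k3, k4⟩, k5, k6⟩ := mem_mulDom.mp hy
    rw [q.compat _ h5 y k2, p.compat x h1 _ k3]

theorem add_congr {p p' q q' : QRep R} (hp : p ≈ p') (hq : q ≈ q') : add p q ≈ add p' q' := by
  obtain ⟨J, h0, h1, h2, h⟩ := hp
  obtain ⟨J', h0', h1', h2', h'⟩ := hq
  refine ⟨J ⊓ J', inf_ne_bot h0 h0', inf_le_inf h1 h1', inf_le_inf h2 h2', fun x hx => ?_⟩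
  rw [TwoSidedIdeal.mem_inf] at hx
  exact ⟨congrArg₂ (· + ·) (h x hx.1).1 (h' x hx.2).1,
    congrArg₂ (· + ·) (h x hx.1).2 (h' x hx.2).2⟩

theorem neg_congr {p p' : QRep R} (hp : p ≈ p') : neg p ≈ neg p' := by
  obtain ⟨J, h0, h1, h2, h⟩ := hp
  exact ⟨J, h0, h1, h2, fun x hx => ⟨congrArg _ (h x hx).1, congrArg _ (h x hx).2⟩⟩

theorem mul_congr {p p' q q' : QRep R} (hp : p ≈ p') (hq : q ≈ q') : mul p q ≈ mul p' q' := by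
  obtain ⟨J, h0, h1, h2, h⟩ := hp
  obtain ⟨J', h0', h1', h2', h'⟩ := hq
  refine ⟨mulDom p q J J' h1 h1', mulDom_ne_bot _ _ _ _ _ _ h0 h0', fun x hx => ?_,
    fun x hx => ?_, fun x hx => ?_⟩
  · obtain ⟨⟨a1, a2⟩, ⟨a3, a4⟩, a5, a6⟩ := mem_mulDom.mp hx
    exact (mem_mulDom (hI := le_rfl) (hJ := le_rfl)).mpr ⟨⟨h1 a1, h1' a2⟩, ⟨h1 a3, fun s => h1 (a4 s)⟩, h1' a5,
      fun s => h1' (a6 s)⟩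
  · obtain ⟨⟨a1, a2⟩, ⟨a3, a4⟩, a5, a6⟩ := mem_mulDom.mp hx
    refine (mem_mulDom (hI := le_rfl) (hJ := le_rfl)).mpr ⟨⟨h2 a1, h2' a2⟩, ⟨?_, fun s => ?_⟩, ?_, fun s => ?_⟩
    · rw [← (h' x a2).1]; exact h2 a3
    · rw [← (h' _ (J'.mul_mem_left s x a2)).1]; exact h2 (a4 s)
    · rw [← (h x a1).2]; exact h2' a5
    · rw [← (h _ (J.mul_mem_right x s a1)).2]; exact h2' (a6 s)
  · obtain ⟨⟨a1, a2⟩, ⟨a3, a4⟩, a5, a6⟩ := mem_mulDom.mp hx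
    change p.lmap (q.lmap x) = p'.lmap (q'.lmap x) ∧ q.rmap (p.rmap x) = q'.rmap (p'.rmap x)
    rw [← (h' x a2).1, ← (h x a1).2]
    exact ⟨(h _ a3).1, (h' _ a5).2⟩

end QRep

end MartindaleSymm

open MartindaleSymm in
/-- The Martindale symmetric ring of quotients `Q_s(R)` of a prime ring `R`. -/
def MartindaleQuotient (R : Type u) [NonUnitalRing R] [IsPrimeRing R] : Type u :=
  Quotient (QRep.setoid R)

namespace MartindaleQuotient

open MartindaleSymm

variable {R : Type u} [NonUnitalRing R] [IsPrimeRing R]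

/-- The class of a representative. -/
def mk (p : QRep R) : MartindaleQuotient R := Quotient.mk _ p

instance : Zero (MartindaleQuotient R) := ⟨mk (QRep.of 0)⟩
instance : One (MartindaleQuotient R) := ⟨mk (QRep.one R)⟩
instance : Add (MartindaleQuotient R) :=
  ⟨Quotient.map₂ QRep.add fun _ _ hp _ _ hq => QRep.add_congr hp hq⟩
instance : Neg (MartindaleQuotient R) := ⟨Quotient.map QRep.neg fun _ _ hp => QRep.neg_congr hp⟩
instance : Mul (MartindaleQuotient R) :=
  ⟨Quotient.map₂ QRep.mul fun _ _ hp _ _ hq => QRep.mul_congr hp hq⟩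

instance : Ring (MartindaleQuotient R) where
  add_assoc := by
    rintro ⟨a⟩ ⟨b⟩ ⟨c⟩
    exact Quotient.sound (QRep.rel_of_eq fun x _ _ => ⟨add_assoc _ _ _, add_assoc _ _ _⟩)
  zero_add := by
    rintro ⟨a⟩
    refine Quotient.sound (QRep.rel_of_eq fun x _ _ => ⟨?_, ?_⟩)
    · change 0 * x + a.lmap x = _; rw [zero_mul, zero_add]
    · change x * 0 + a.rmap x = _; rw [mul_zero, zero_add]
  add_zero := by
    rintro ⟨a⟩
    refine Quotient.sound (QRep.rel_of_eq fun x _ _ => ⟨?_, ?_⟩)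
    · change a.lmap x + 0 * x = _; rw [zero_mul, add_zero]
    · change a.rmap x + x * 0 = _; rw [mul_zero, add_zero]
  add_comm := by
    rintro ⟨a⟩ ⟨b⟩
    exact Quotient.sound (QRep.rel_of_eq fun x _ _ => ⟨add_comm _ _, add_comm _ _⟩)
  neg_add_cancel := by
    rintro ⟨a⟩
    refine Quotient.sound (QRep.rel_of_eq fun x _ _ => ⟨?_, ?_⟩)
    · change -a.lmap x + a.lmap x = 0 * x; rw [zero_mul, neg_add_cancel]
    · change -a.rmap x + a.rmap x = x * 0; rw [mul_zero, neg_add_cancel]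
  mul_assoc := by
    rintro ⟨a⟩ ⟨b⟩ ⟨c⟩
    exact Quotient.sound (QRep.rel_of_eq fun x _ _ => ⟨rfl, rfl⟩)
  one_mul := by
    rintro ⟨a⟩
    exact Quotient.sound (QRep.rel_of_eq fun x _ _ => ⟨rfl, rfl⟩)
  mul_one := by
    rintro ⟨a⟩
    exact Quotient.sound (QRep.rel_of_eq fun x _ _ => ⟨rfl, rfl⟩)
  zero_mul := by
    rintro ⟨a⟩
    refine Quotient.sound (QRep.rel_of_eq fun x _ _ => ⟨?_, ?_⟩)
    · change 0 * a.lmap x = 0 * x; rw [zero_mul, zero_mul]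
    · change a.rmap (x * 0) = x * 0; rw [mul_zero, a.rmap_zero]
  mul_zero := by
    rintro ⟨a⟩
    refine Quotient.sound (QRep.rel_of_eq fun x _ _ => ⟨?_, ?_⟩)
    · change a.lmap (0 * x) = 0 * x; rw [zero_mul, a.lmap_zero]
    · change a.rmap x * 0 = x * 0; rw [mul_zero, mul_zero]
  left_distrib := by
    rintro ⟨a⟩ ⟨b⟩ ⟨c⟩
    refine Quotient.sound (QRep.rel_of_eq fun x _ hx => ⟨?_, rfl⟩)
    obtain ⟨h, h'⟩ := (TwoSidedIdeal.mem_inf R).mp hx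
    exact a.lmap_add _ ((QRep.mem_mulDom (hI := le_rfl) (hJ := le_rfl)).mp h).2.1.1 _ ((QRep.mem_mulDom (hI := le_rfl) (hJ := le_rfl)).mp h').2.1.1
  right_distrib := by
    rintro ⟨a⟩ ⟨b⟩ ⟨c⟩
    refine Quotient.sound (QRep.rel_of_eq fun x _ hx => ⟨rfl, ?_⟩)
    obtain ⟨h, h'⟩ := (TwoSidedIdeal.mem_inf R).mp hx
    exact c.rmap_add _ ((QRep.mem_mulDom (hI := le_rfl) (hJ := le_rfl)).mp h).2.2.1 _ ((QRep.mem_mulDom (hI := le_rfl) (hJ := le_rfl)).mp h').2.2.1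
  nsmul := nsmulRec
  zsmul := zsmulRec

/-- The canonical embedding `R → Q_s(R)`. -/
def of (R : Type u) [NonUnitalRing R] [IsPrimeRing R] : R →ₙ+* MartindaleQuotient R where
  toFun a := mk (QRep.of a)
  map_zero' := rfl
  map_add' a b :=
    Quotient.sound (QRep.rel_of_eq fun x _ _ => ⟨add_mul a b x, mul_add x a b⟩)
  map_mul' a b :=
    Quotient.sound (QRep.rel_of_eq fun x _ _ => ⟨mul_assoc a b x, (mul_assoc x a b).symm⟩)

end MartindaleQuotient

/-- The extended centroid `C` of a prime ring `R`: the center of `Q_s(R)`. -/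
abbrev ExtendedCentroid (R : Type u) [NonUnitalRing R] [IsPrimeRing R] :
    Subring (MartindaleQuotient R) :=
  Subring.center (MartindaleQuotient R)

/-- For a subset `A` of `R`, the `C`-subspace `AC` of `Q_s(R)`: all finite sums of products `a c`
with `a` in the additive subgroup generated by `A` and `c ∈ C`. -/
def mulExtendedCentroid {R : Type u} [NonUnitalRing R] [IsPrimeRing R] (A : Set R) :
    Submodule (ExtendedCentroid R) (MartindaleQuotient R) :=
  Submodule.span (ExtendedCentroid R) (MartindaleQuotient.of R '' A)

/-!
Let `x` be a noncentral element of `Q_s(R)` such that `ad x ∘ ad y` vanishes on `R`. The Leibniz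
rule turns this into `[y, r] s [x, t] + [x, r] s [y, t] = 0`, and Martindale's lemma then gives
`y ∈ C x + C`. If `x` centralizes `K`, this applies to every `y ∈ K`, so `K C ⊆ C x + C`; since a
Lie ideal contained in a line is central, `K C = C x + C` has dimension `2`.

Conversely, let `dim K C ≤ 2`. If `a, b ∈ K` do not commute, they form a basis of `K C`, hence all
brackets of elements of `K C` lie in the line `C [a, b]`. By the Jacobi identity this line is
stable under bracketing with `R`, so `[a, b] = α a + β b` is central, and bracketing with `b` and
`a` gives `α = β = 0`. Thus `K` is commutative, and `K C` consists of elements centralizing `K`.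
-/

theorem rank_span_pair_le {F V : Type*} [Semiring F] [StrongRankCondition F] [AddCommMonoid V]
    [Module F V] (a b : V) : Module.rank F (Submodule.span F {a, b}) ≤ 2 := by
  classical
  have h := rank_span_finset_le (R := F) ({a, b} : Finset V)
  rw [Finset.coe_pair] at h
  exact h.trans (mod_cast Finset.card_le_two)

theorem two_le_rank_of_linearIndependent_pair {F V : Type*} [Semiring F] [Nontrivial F]
    [AddCommMonoid V] [Module F V] {W : Submodule F V} {a b : V} (ha : a ∈ W) (hb : b ∈ W)
    (hab : LinearIndependent F ![a, b]) : 2 ≤ Module.rank F W := by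
  have hW : LinearIndependent F ![(⟨a, ha⟩ : W), ⟨b, hb⟩] := by
    refine LinearIndependent.of_comp W.subtype ?_
    convert hab using 1
    ext i
    fin_cases i <;> rfl
  simpa using hW.cardinal_lift_le_rank

theorem span_pair_eq_of_rank_le_two {F V : Type*} [DivisionRing F] [AddCommGroup V] [Module F V]
    {W : Submodule F V} {a b : V} (ha : a ∈ W) (hb : b ∈ W) (hab : LinearIndependent F ![a, b])
    (hW : Module.rank F W ≤ 2) : Submodule.span F {a, b} = W := by
  have : FiniteDimensional F W :=
    Module.rank_lt_aleph0_iff.mp (hW.trans_lt Cardinal.ofNat_lt_aleph0)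
  refine Submodule.eq_of_le_of_finrank_le (Submodule.span_le.mpr (Set.pair_subset ha hb)) ?_
  have hfinrank := finrank_span_eq_card hab
  rw [Matrix.range_cons_cons_empty, Fintype.card_fin] at hfinrank
  rw [hfinrank]
  exact Module.finrank_le_of_rank_le hW

section LieAlgebra

variable {F L : Type*} [LieRing L]

theorem lie_mem_span_singleton_lie [CommRing F] [LieAlgebra F L] {a b x y : L}
    (hx : x ∈ Submodule.span F {a, b}) (hy : y ∈ Submodule.span F {a, b}) :
    ⁅x, y⁆ ∈ Submodule.span F {⁅a, b⁆} := by
  obtain ⟨α, β, rfl⟩ := Submodule.mem_span_pair.mp hx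
  obtain ⟨γ, δ, rfl⟩ := Submodule.mem_span_pair.mp hy
  refine Submodule.mem_span_singleton.mpr ⟨α * δ - β * γ, ?_⟩
  simp only [add_lie, lie_add, smul_lie, lie_smul, lie_self, smul_zero, ← lie_skew a b]
  module

theorem linearIndependent_pair_of_lie_ne_zero [CommRing F] [IsDomain F] [LieAlgebra F L]
    [Module.IsTorsionFree F L] {a b : L} (hab : ⁅a, b⁆ ≠ 0) : LinearIndependent F ![a, b] := by
  refine LinearIndependent.pair_iff.mpr fun α β h => ⟨?_, ?_⟩
  · have hb : α • ⁅a, b⁆ = 0 := by simpa using congrArg (⁅·, b⁆) h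
    exact (smul_eq_zero.mp hb).resolve_right hab
  · have ha : β • ⁅a, b⁆ = 0 := by simpa using congrArg (⁅a, ·⁆) h
    exact (smul_eq_zero.mp ha).resolve_right hab

theorem lie_eq_zero_of_mem_span_pair [CommRing F] [IsDomain F] [LieAlgebra F L]
    [Module.IsTorsionFree F L] {a b : L} (hmem : ⁅a, b⁆ ∈ Submodule.span F {a, b})
    (ha : ⁅a, ⁅a, b⁆⁆ = 0) (hb : ⁅⁅a, b⁆, b⁆ = 0) : ⁅a, b⁆ = 0 := by
  obtain ⟨α, β, h⟩ := Submodule.mem_span_pair.mp hmem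
  by_contra hab
  have hα : α • ⁅a, b⁆ = 0 := by simpa [← h] using hb
  have hβ : β • ⁅a, b⁆ = 0 := by simpa [← h] using ha
  rw [(smul_eq_zero.mp hα).resolve_right hab, (smul_eq_zero.mp hβ).resolve_right hab] at h
  exact hab (by simpa using h.symm)

variable [Field F] [LieAlgebra F L]

theorem span_pair_eq_of_lie_ne_zero {V : Submodule F L} (hV : Module.rank F V ≤ 2) {a b : L}
    (ha : a ∈ V) (hb : b ∈ V) (hab : ⁅a, b⁆ ≠ 0) : Submodule.span F {a, b} = V :=
  span_pair_eq_of_rank_le_two ha hb (linearIndependent_pair_of_lie_ne_zero hab) hV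

theorem lie_lie_mem_span_singleton_of_rank_le_two {V : Submodule F L}
    (hV : Module.rank F V ≤ 2) {a b x : L} (ha : a ∈ V) (hb : b ∈ V) (hax : ⁅a, x⁆ ∈ V)
    (hbx : ⁅b, x⁆ ∈ V) : ⁅⁅a, b⁆, x⁆ ∈ Submodule.span F {⁅a, b⁆} := by
  by_cases hab : ⁅a, b⁆ = 0
  · simp [hab]
  have hspan := span_pair_eq_of_lie_ne_zero hV ha hb hab
  rw [← hspan] at ha hb hax hbx
  have jacobi : ⁅⁅a, b⁆, x⁆ = ⁅a, ⁅b, x⁆⁆ - ⁅b, ⁅a, x⁆⁆ := lie_lie a b x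
  rw [jacobi]
  exact sub_mem (lie_mem_span_singleton_lie ha hbx) (lie_mem_span_singleton_lie hb hax)

end LieAlgebra

section Associative

variable {G A H : Type*} [Semigroup G] [NonUnitalRing A] [FunLike H G A] [MulHomClass H G A]

theorem lie_mul_mul_lie_add_eq_zero (f : H) {x y : A} (h : ∀ r, ⁅x, ⁅y, f r⁆⁆ = 0) (r s t : G) :
    ⁅y, f r⁆ * f s * ⁅x, f t⁆ + ⁅x, f r⁆ * f s * ⁅y, f t⁆ = 0 := by
  have leibniz (r s : G) : ⁅y, f r⁆ * ⁅x, f s⁆ + ⁅x, f r⁆ * ⁅y, f s⁆ = 0 := by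
    have expand : ⁅x, ⁅y, f r * f s⁆⁆ = ⁅x, ⁅y, f r⁆⁆ * f s + ⁅y, f r⁆ * ⁅x, f s⁆ +
        ⁅x, f r⁆ * ⁅y, f s⁆ + f r * ⁅x, ⁅y, f s⁆⁆ := by
      simp only [Ring.lie_def]
      noncomm_ring
    rw [← map_mul, h, h, h, zero_mul, mul_zero, zero_add, add_zero] at expand
    exact expand.symm
  have expand : ⁅y, f r⁆ * ⁅x, f s * f t⁆ + ⁅x, f r⁆ * ⁅y, f s * f t⁆ =
      (⁅y, f r⁆ * ⁅x, f s⁆ + ⁅x, f r⁆ * ⁅y, f s⁆) * f t +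
        (⁅y, f r⁆ * f s * ⁅x, f t⁆ + ⁅x, f r⁆ * f s * ⁅y, f t⁆) := by
    simp only [Ring.lie_def]
    noncomm_ring
  rw [← map_mul, leibniz, leibniz, zero_mul, zero_add] at expand
  exact expand.symm

theorem lie_eq_zero_of_lie_mem_span_singleton {F : Type*} [Field F] [Module F A]
    [IsScalarTower F A A] [SMulCommClass F A A] (f : H) {a : G}
    (hprime : (∀ r, f a * f r * f a = 0) → f a = 0)
    (h : ∀ r, ⁅f a, f r⁆ ∈ Submodule.span F {f a}) (r : G) : ⁅f a, f r⁆ = 0 := by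
  by_contra hr
  obtain ⟨c, hc⟩ := Submodule.mem_span_singleton.mp (h r)
  have ha0 : f a ≠ 0 := fun h0 => hr (by rw [← hc, h0, smul_zero])
  have hc0 : c ≠ 0 := fun h0 => hr (by rw [← hc, h0, zero_smul])
  obtain ⟨m, hsq⟩ : ∃ m : F, f a * f a = m • f a := by
    obtain ⟨d, hd⟩ := Submodule.mem_span_singleton.mp (h (r * a))
    refine ⟨c⁻¹ * d, ?_⟩
    have hlie : ⁅f a, f (r * a)⁆ = ⁅f a, f r⁆ * f a := by
      simp only [Ring.lie_def, map_mul]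
      noncomm_ring
    rw [mul_smul, hd, hlie, ← hc, smul_mul_assoc, inv_smul_smul₀ hc0]
  have hm : m = 0 := by
    have hzero : f a * ⁅f a, f r⁆ * f a = 0 := by
      have expand : f a * ⁅f a, f r⁆ * f a = f a * f a * (f r * f a) - f a * f r * (f a * f a) := by
        simp only [Ring.lie_def]
        noncomm_ring
      rw [expand, hsq, smul_mul_assoc, mul_smul_comm, mul_assoc, sub_self]
    rw [← hc, mul_smul_comm, hsq, smul_mul_assoc, smul_mul_assoc, hsq] at hzero
    simpa [hc0, ha0] using hzero
  rw [hm, zero_smul] at hsq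
  refine ha0 (hprime fun s => ?_)
  obtain ⟨d, hd⟩ := Submodule.mem_span_singleton.mp (h s)
  calc f a * f s * f a = f a * f a * f s - f a * ⁅f a, f s⁆ := by
        simp only [Ring.lie_def]
        noncomm_ring
    _ = 0 := by rw [hsq, zero_mul, ← hd, mul_smul_comm, hsq, smul_zero, sub_zero]

end Associative

attribute [local instance] LieRing.ofAssociativeRing

namespace MartindaleQuotient

open MartindaleSymm

variable {R : Type u} [NonUnitalRing R] [IsPrimeRing R]

theorem mk_mul_of (p : QRep R) {x : R} (hx : x ∈ p.dom) : mk p * of R x = of R (p.lmap x) :=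
  Quotient.sound <| QRep.rel_of_eq fun y hy _ =>
    have hdom := (QRep.mem_mulDom (hI := le_rfl) (hJ := le_rfl)).mp hy
    ⟨p.lmap_mul x hx y, p.compat y hdom.1.1 x hx⟩

theorem of_mul_mk (p : QRep R) {x : R} (hx : x ∈ p.dom) : of R x * mk p = of R (p.rmap x) :=
  Quotient.sound <| QRep.rel_of_eq fun y hy _ =>
    have hdom := (QRep.mem_mulDom (hI := le_rfl) (hJ := le_rfl)).mp hy
    ⟨(p.compat x hx y hdom.1.2).symm, p.rmap_mul x hx y⟩

theorem eq_zero_of_forall_mem_mul {J : TwoSidedIdeal R} (hJ : J ≠ ⊥) {a : R}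
    (h : ∀ x ∈ J, a * x = 0) : a = 0 := by
  obtain ⟨x, hx, hx0⟩ := exists_mem_ne_zero hJ
  refine (IsPrimeRing.eq_zero_or_eq_zero a x fun r => ?_).resolve_right hx0
  rw [mul_assoc, h _ (J.mul_mem_left _ _ hx)]

theorem eq_zero_of_forall_mul_mem {J : TwoSidedIdeal R} (hJ : J ≠ ⊥) {a : R}
    (h : ∀ x ∈ J, x * a = 0) : a = 0 := by
  obtain ⟨x, hx, hx0⟩ := exists_mem_ne_zero hJ
  exact (IsPrimeRing.eq_zero_or_eq_zero x a fun r => h _ (J.mul_mem_right _ _ hx)).resolve_left hx0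

theorem of_injective : Function.Injective (of R) := by
  refine (injective_iff_map_eq_zero _).mpr fun a ha => ?_
  obtain ⟨J, hJ, -, -, h⟩ := Quotient.exact (ha : mk (QRep.of a) = mk (QRep.of 0))
  exact eq_zero_of_forall_mem_mul hJ fun x hx => (h x hx).1.trans (zero_mul x)

theorem exists_ideal_mul_mem_range_of (q : MartindaleQuotient R) :
    ∃ I : TwoSidedIdeal R, I ≠ ⊥ ∧ ∀ x ∈ I, q * of R x ∈ Set.range (of R) := by
  obtain ⟨p, rfl⟩ := Quotient.exists_rep q
  exact ⟨p.dom, p.dom_ne_bot, fun x hx => ⟨_, (mk_mul_of p hx).symm⟩⟩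

theorem exists_ideal_of_mul_mem_range_of (q : MartindaleQuotient R) :
    ∃ I : TwoSidedIdeal R, I ≠ ⊥ ∧ ∀ x ∈ I, of R x * q ∈ Set.range (of R) := by
  obtain ⟨p, rfl⟩ := Quotient.exists_rep q
  exact ⟨p.dom, p.dom_ne_bot, fun x hx => ⟨_, (of_mul_mk p hx).symm⟩⟩

theorem eq_zero_of_forall_mul_of {I : TwoSidedIdeal R} (hI : I ≠ ⊥) {q : MartindaleQuotient R}
    (h : ∀ x ∈ I, q * of R x = 0) : q = 0 := by
  obtain ⟨p, rfl⟩ := Quotient.exists_rep q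
  have hJ := inf_ne_bot hI p.dom_ne_bot
  have hlmap : ∀ x ∈ I ⊓ p.dom, p.lmap x = 0 := fun x hx => by
    rw [TwoSidedIdeal.mem_inf] at hx
    apply of_injective
    rw [← mk_mul_of p hx.2, map_zero]
    exact h x hx.1
  have hrmap : ∀ x ∈ I ⊓ p.dom, p.rmap x = 0 := fun x hx =>
    eq_zero_of_forall_mem_mul hJ fun y hy => by
      rw [p.compat x ((TwoSidedIdeal.mem_inf R).mp hx).2 y ((TwoSidedIdeal.mem_inf R).mp hy).2,
        hlmap y hy, mul_zero]
  exact Quotient.sound ⟨I ⊓ p.dom, hJ, inf_le_right, le_top, fun x hx =>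
    ⟨(hlmap x hx).trans (zero_mul x).symm, (hrmap x hx).trans (mul_zero x).symm⟩⟩

theorem eq_zero_of_forall_of_mul {I : TwoSidedIdeal R} (hI : I ≠ ⊥) {q : MartindaleQuotient R}
    (h : ∀ x ∈ I, of R x * q = 0) : q = 0 := by
  obtain ⟨J, hJ, hq⟩ := exists_ideal_mul_mem_range_of q
  refine eq_zero_of_forall_mul_of hJ fun y hy => ?_
  obtain ⟨z, hz⟩ := hq y hy
  have hIz : ∀ x ∈ I, x * z = 0 := fun x hx => of_injective <| by
    rw [map_mul, hz, ← mul_assoc, h x hx, zero_mul, map_zero]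
  rw [← hz, eq_zero_of_forall_mul_mem hI hIz, map_zero]

theorem eq_zero_or_eq_zero_of_forall_mul_of_mul {p q : MartindaleQuotient R}
    (h : ∀ s, p * of R s * q = 0) : p = 0 ∨ q = 0 := by
  obtain ⟨I, hI, hp⟩ := exists_ideal_of_mul_mem_range_of p
  obtain ⟨J, hJ, hq⟩ := exists_ideal_mul_mem_range_of q
  by_contra! hpq
  obtain ⟨x, hx, hxp⟩ : ∃ x ∈ I, of R x * p ≠ 0 := by
    by_contra! hann
    exact hpq.1 (eq_zero_of_forall_of_mul hI hann)
  obtain ⟨y, hy, hqy⟩ : ∃ y ∈ J, q * of R y ≠ 0 := by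
    by_contra! hann
    exact hpq.2 (eq_zero_of_forall_mul_of hJ hann)
  obtain ⟨a, ha⟩ := hp x hx
  obtain ⟨b, hb⟩ := hq y hy
  have hab : ∀ s, a * s * b = 0 := fun s => of_injective <| by
    calc of R (a * s * b) = of R x * (p * of R s * q) * of R y := by
          rw [map_mul, map_mul, ha, hb]
          simp only [mul_assoc]
      _ = of R 0 := by rw [h, mul_zero, zero_mul, map_zero]
  rcases IsPrimeRing.eq_zero_or_eq_zero a b hab with rfl | rfl
  · exact hxp (ha.symm.trans (map_zero _))
  · exact hqy (hb.symm.trans (map_zero _))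

theorem eq_of_forall_mul_of_mul_eq {p q q' : MartindaleQuotient R} (hp : p ≠ 0)
    (h : ∀ s, p * of R s * q = p * of R s * q') : q = q' := by
  refine sub_eq_zero.mp ((eq_zero_or_eq_zero_of_forall_mul_of_mul fun s => ?_).resolve_left hp)
  rw [mul_sub, h, sub_self]

instance : Nontrivial (MartindaleQuotient R) := of_injective.nontrivial

theorem of_lie (a b : R) : of R ⁅a, b⁆ = ⁅of R a, of R b⁆ := by
  simp only [Ring.lie_def, map_sub, map_mul]

theorem mem_extendedCentroid_iff {q : MartindaleQuotient R} :
    q ∈ ExtendedCentroid R ↔ ∀ r, ⁅q, of R r⁆ = 0 := by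
  refine ⟨fun hq r => Commute.lie_eq (Subring.mem_center_iff.mp hq _).symm, fun h => ?_⟩
  have hcomm : ∀ r, q * of R r = of R r * q := fun r => sub_eq_zero.mp (h r)
  refine Subring.mem_center_iff.mpr fun t => sub_eq_zero.mp ?_
  obtain ⟨I, hI, ht⟩ := exists_ideal_mul_mem_range_of t
  refine eq_zero_of_forall_mul_of hI fun x hx => ?_
  obtain ⟨y, hy⟩ := ht x hx
  rw [sub_mul, mul_assoc, mul_assoc, hcomm, ← hy, ← mul_assoc, ← hy, hcomm, sub_self]

theorem of_mem_extendedCentroid_iff {a : R} : of R a ∈ ExtendedCentroid R ↔ a ∈ Set.center R := by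
  rw [mem_extendedCentroid_iff, Semigroup.mem_center_iff]
  refine forall_congr' fun r => ?_
  rw [← of_lie, map_eq_zero_iff _ of_injective, ← commute_iff_lie_eq]
  exact Commute.symm_iff

theorem exists_extendedCentroid_smul_of_eq {J : TwoSidedIdeal R} (hJ : J ≠ ⊥) {f : R → R}
    (hadd : ∀ x ∈ J, ∀ y ∈ J, f (x + y) = f x + f y)
    (hright : ∀ x ∈ J, ∀ s, f (x * s) = f x * s) (hleft : ∀ x ∈ J, ∀ s, f (s * x) = s * f x) :
    ∃ c : ExtendedCentroid R, ∀ x ∈ J, c • of R x = of R (f x) := by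
  let p : QRep R := ⟨J, hJ, f, f, hadd, hadd, hright, hleft, fun x hx y hy => by
    rw [← hright x hx, ← hleft y hy]⟩
  have hp : ∀ x ∈ J, mk p * of R x = of R (f x) := fun x hx => mk_mul_of p hx
  refine ⟨⟨mk p, mem_extendedCentroid_iff.mpr fun r => ?_⟩, hp⟩
  refine eq_zero_of_forall_mul_of hJ fun x hx => ?_
  rw [Ring.lie_def, sub_mul, mul_assoc, mul_assoc, hp x hx, ← map_mul, ← map_mul,
    hp _ (J.mul_mem_left _ _ hx), hleft x hx, sub_self]

/-- The domain of the formal quotient `c = q / p`: the ideal of all `w ∈ R` for which some `z ∈ R`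
plays the role of `c w`. The middle factor `s` makes the condition stable under `w ↦ u w`. -/
def ratioDom (p q : MartindaleQuotient R) : TwoSidedIdeal R :=
  .mk' {w | ∃ z, ∀ s, p * of R s * of R z = q * of R s * of R w}
    ⟨0, fun s => by simp only [map_zero, mul_zero]⟩
    (by
      rintro w w' ⟨z, hz⟩ ⟨z', hz'⟩
      exact ⟨z + z', fun s => by rw [map_add, map_add, mul_add, mul_add, hz, hz']⟩)
    (by
      rintro w ⟨z, hz⟩
      exact ⟨-z, fun s => by rw [map_neg, map_neg, mul_neg, mul_neg, hz]⟩)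
    (by
      rintro u w ⟨z, hz⟩
      exact ⟨u * z, fun s => by simpa only [map_mul, mul_assoc] using hz (s * u)⟩)
    (by
      rintro w u ⟨z, hz⟩
      exact ⟨z * u, fun s => by rw [map_mul, map_mul, ← mul_assoc, hz, mul_assoc]⟩)

theorem mem_ratioDom {p q : MartindaleQuotient R} {w : R} :
    w ∈ ratioDom p q ↔ ∃ z, ∀ s, p * of R s * of R z = q * of R s * of R w :=
  TwoSidedIdeal.mem_mk' ..

theorem ratioDom_ne_bot {p q q' : MartindaleQuotient R} (hp : p ≠ 0)
    (h : ∀ s, p * of R s * q' = q * of R s * p) : ratioDom p q ≠ ⊥ := by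
  obtain ⟨I, hI, hpI⟩ := exists_ideal_mul_mem_range_of p
  obtain ⟨J, hJ, hqJ⟩ := exists_ideal_mul_mem_range_of q'
  obtain ⟨y, hy, hpy⟩ : ∃ y ∈ I ⊓ J, p * of R y ≠ 0 := by
    by_contra! hann
    exact hp (eq_zero_of_forall_mul_of (inf_ne_bot hI hJ) hann)
  rw [TwoSidedIdeal.mem_inf] at hy
  obtain ⟨w, hw⟩ := hpI y hy.1
  obtain ⟨z, hz⟩ := hqJ y hy.2
  have hmem : w ∈ ratioDom p q :=
    mem_ratioDom.mpr ⟨z, fun s => by rw [hz, hw, ← mul_assoc, h, mul_assoc]⟩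
  refine ne_bot_of_mem hmem ?_
  rintro rfl
  exact hpy (hw.symm.trans (map_zero _))

theorem exists_smul_of_eq_on_ratioDom {p q : MartindaleQuotient R} (hp : p ≠ 0)
    (hdom : ratioDom p q ≠ ⊥) : ∃ c : ExtendedCentroid R, ∀ w ∈ ratioDom p q, ∀ s,
      p * of R s * (c • of R w) = q * of R s * of R w := by
  choose! f hf using fun w => (mem_ratioDom (p := p) (q := q) (w := w)).mp
  have heq {z z' : R} (hz : ∀ s, p * of R s * of R z = p * of R s * of R z') : z = z' :=
    of_injective (eq_of_forall_mul_of_mul_eq hp hz)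
  obtain ⟨c, hc⟩ := exists_extendedCentroid_smul_of_eq hdom (f := f)
    (fun x hx y hy => heq fun s => by
      rw [hf _ (add_mem hx hy), map_add, map_add, mul_add, mul_add, hf x hx, hf y hy])
    (fun x hx u => heq fun s => by
      rw [hf _ (TwoSidedIdeal.mul_mem_right _ _ _ hx), map_mul, map_mul, ← mul_assoc,
        ← mul_assoc, hf x hx])
    (fun x hx u => heq fun s => by
      rw [hf _ (TwoSidedIdeal.mul_mem_left _ _ _ hx)]
      simpa only [map_mul, mul_assoc] using (hf x hx (s * u)).symm)
  exact ⟨c, fun w hw s => by rw [hc w hw, hf w hw]⟩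

/-- Martindale's lemma: the formal quotient `w ↦ z` of `q` by `p` on `ratioDom p q` is a bimodule
map into `R`, i.e. an element of the extended centroid. -/
theorem exists_eq_smul_of_forall_mul_of_mul_eq {p q q' : MartindaleQuotient R} (hp : p ≠ 0)
    (h : ∀ s, p * of R s * q' = q * of R s * p) : ∃ c : ExtendedCentroid R, q = c • p := by
  have hdom := ratioDom_ne_bot hp h
  obtain ⟨c, hc⟩ := exists_smul_of_eq_on_ratioDom hp hdom
  obtain ⟨w, hw, hw0⟩ := exists_mem_ne_zero hdom
  refine ⟨c, sub_eq_zero.mp ((eq_zero_or_eq_zero_of_forall_mul_of_mul (q := of R w)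
    fun s => ?_).resolve_right fun h0 => hw0 (of_injective (h0.trans (map_zero _).symm)))⟩
  rw [sub_mul, sub_mul, ← hc w hw, smul_mul_assoc, smul_mul_assoc, mul_smul_comm, sub_self]

theorem isUnit_or_eq_zero_of_extendedCentroid (c : ExtendedCentroid R) : IsUnit c ∨ c = 0 := by
  refine or_iff_not_imp_right.mpr fun hc => isUnit_iff_exists_inv'.mpr ?_
  have hc0 : (c : MartindaleQuotient R) ≠ 0 := fun h0 => hc (Subtype.ext h0)
  obtain ⟨d, hd⟩ := exists_eq_smul_of_forall_mul_of_mul_eq (q := 1) (q' := 1) hc0 fun s => by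
    rw [mul_one, one_mul, Subring.mem_center_iff.mp c.2]
  exact ⟨d, Subtype.ext hd.symm⟩

noncomputable scoped instance : Field (ExtendedCentroid R) :=
  Field.ofIsUnitOrEqZero isUnit_or_eq_zero_of_extendedCentroid

theorem mem_span_pair_one_of_lie_lie_eq_zero {x y : MartindaleQuotient R}
    (hx : x ∉ ExtendedCentroid R) (h : ∀ r, ⁅x, ⁅y, of R r⁆⁆ = 0) :
    y ∈ Submodule.span (ExtendedCentroid R) {x, 1} := by
  have hlie := lie_mul_mul_lie_add_eq_zero (of R) h
  obtain ⟨r, hr⟩ : ∃ r, ⁅x, of R r⁆ ≠ 0 := by simpa [mem_extendedCentroid_iff] using hx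
  obtain ⟨c, hc⟩ : ∃ c : ExtendedCentroid R, ⁅y, of R r⁆ = c • ⁅x, of R r⁆ :=
    exists_eq_smul_of_forall_mul_of_mul_eq (q' := -⁅y, of R r⁆) hr fun s => by
      rw [mul_neg, eq_neg_of_add_eq_zero_left (hlie r s r)]
  have hmem : y + c • x ∈ ExtendedCentroid R := by
    refine mem_extendedCentroid_iff.mpr fun t => ?_
    refine eq_of_forall_mul_of_mul_eq hr fun s => ?_
    calc ⁅x, of R r⁆ * of R s * ⁅y + c • x, of R t⁆
        = ⁅y, of R r⁆ * of R s * ⁅x, of R t⁆ + ⁅x, of R r⁆ * of R s * ⁅y, of R t⁆ := by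
          rw [add_lie, smul_lie, mul_add, mul_smul_comm, hc, smul_mul_assoc, smul_mul_assoc,
            add_comm]
      _ = ⁅x, of R r⁆ * of R s * 0 := by rw [hlie, mul_zero]
  refine Submodule.mem_span_pair.mpr ⟨-c, ⟨_, hmem⟩, ?_⟩
  simp [Subring.smul_def]

theorem lie_of_eq_zero_of_lie_of_mem_span_singleton {a : R}
    (h : ∀ r, ⁅of R a, of R r⁆ ∈ Submodule.span (ExtendedCentroid R) {of R a}) (r : R) :
    ⁅of R a, of R r⁆ = 0 :=
  lie_eq_zero_of_lie_mem_span_singleton (of R)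
    (fun hprime => (eq_zero_or_eq_zero_of_forall_mul_of_mul hprime).elim id id) h r

theorem mulExtendedCentroid_subset_centralizer {A : Set R} (hA : A ⊆ Set.centralizer A) :
    (mulExtendedCentroid A : Set (MartindaleQuotient R)) ⊆ Set.centralizer (of R '' A) := by
  suffices mulExtendedCentroid A ≤
      Subalgebra.toSubmodule (Subalgebra.centralizer (ExtendedCentroid R) (of R '' A)) from this
  refine Submodule.span_le.mpr ?_
  rintro _ ⟨b, hb, rfl⟩
  rintro _ ⟨a, ha, rfl⟩
  rw [← map_mul, ← map_mul, hA hb a ha]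

theorem of_mem_mulExtendedCentroid {A : Set R} {a : R} (ha : a ∈ A) :
    of R a ∈ mulExtendedCentroid A :=
  Submodule.subset_span ⟨a, ha, rfl⟩

end MartindaleQuotient

namespace IsLieIdeal

open MartindaleQuotient

theorem lie_mem {R : Type u} [NonUnitalRing R] {K : AddSubgroup R} (hK : IsLieIdeal K) {a : R}
    (ha : a ∈ K) (r : R) : ⁅a, r⁆ ∈ K :=
  hK a ha r

variable {R : Type u} [NonUnitalRing R] [IsPrimeRing R] {K : AddSubgroup R}

theorem lie_of_mem_mulExtendedCentroid (hK : IsLieIdeal K) {a : R} (ha : a ∈ K) (r : R) :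
    ⁅of R a, of R r⁆ ∈ mulExtendedCentroid (K : Set R) :=
  of_lie a r ▸ of_mem_mulExtendedCentroid (hK.lie_mem ha r)

theorem two_le_rank (hK : IsLieIdeal K) (hnc : ¬ (K : Set R) ⊆ Set.center R) :
    2 ≤ Module.rank (ExtendedCentroid R) (mulExtendedCentroid (K : Set R)) := by
  obtain ⟨a, ha, hac⟩ := Set.not_subset.mp hnc
  obtain ⟨r, hr⟩ : ∃ r, ⁅of R a, of R r⁆ ∉ Submodule.span (ExtendedCentroid R) {of R a} := by
    by_contra! hline
    rw [← of_mem_extendedCentroid_iff, mem_extendedCentroid_iff] at hac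
    exact hac (lie_of_eq_zero_of_lie_of_mem_span_singleton hline)
  have ha0 : of R a ≠ 0 := fun h0 => hr (by simp [h0])
  have hindep : LinearIndependent (ExtendedCentroid R) ![of R a, ⁅of R a, of R r⁆] :=
    (LinearIndependent.pair_iff' ha0).mpr fun c hc =>
      hr (Submodule.mem_span_singleton.mpr ⟨c, hc⟩)
  exact two_le_rank_of_linearIndependent_pair (of_mem_mulExtendedCentroid ha)
    (hK.lie_of_mem_mulExtendedCentroid ha r) hindep

theorem mulExtendedCentroid_le_span_pair_one (hK : IsLieIdeal K) {x : MartindaleQuotient R}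
    (hx : x ∉ ExtendedCentroid R) (hxK : x ∈ Set.centralizer (of R '' (K : Set R))) :
    mulExtendedCentroid (K : Set R) ≤ Submodule.span (ExtendedCentroid R) {x, 1} := by
  refine Submodule.span_le.mpr ?_
  rintro _ ⟨a, ha, rfl⟩
  refine mem_span_pair_one_of_lie_lie_eq_zero hx fun r => ?_
  rw [← of_lie]
  exact Commute.lie_eq (hxK _ ⟨_, hK.lie_mem ha r, rfl⟩).symm

theorem subset_centralizer_of_rank_le_two (hK : IsLieIdeal K)
    (hrank : Module.rank (ExtendedCentroid R) (mulExtendedCentroid (K : Set R)) ≤ 2) :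
    (K : Set R) ⊆ Set.centralizer (K : Set R) := by
  intro b hb a ha
  have haC := of_mem_mulExtendedCentroid (A := (K : Set R)) ha
  have hbC := of_mem_mulExtendedCentroid (A := (K : Set R)) hb
  have hcentral : ∀ r, ⁅⁅of R a, of R b⁆, of R r⁆ = 0 := by
    rw [← of_lie]
    refine lie_of_eq_zero_of_lie_of_mem_span_singleton fun r => ?_
    rw [of_lie]
    exact lie_lie_mem_span_singleton_of_rank_le_two hrank haC hbC
      (hK.lie_of_mem_mulExtendedCentroid ha r) (hK.lie_of_mem_mulExtendedCentroid hb r)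
  have hzero : ⁅of R a, of R b⁆ = 0 := by
    by_contra hab
    refine hab (lie_eq_zero_of_mem_span_pair (F := ExtendedCentroid R) ?_ ?_ (hcentral b))
    · rw [span_pair_eq_of_lie_ne_zero hrank haC hbC hab]
      exact hK.lie_of_mem_mulExtendedCentroid ha b
    · rw [← lie_skew, hcentral, neg_zero]
  rw [← of_lie, map_eq_zero_iff _ of_injective] at hzero
  exact sub_eq_zero.mp hzero

section Noncentral

variable (hK : IsLieIdeal K) (hnc : ¬ (K : Set R) ⊆ Set.center R)

include hK hnc

theorem rank_eq_two_of_mem_centralizer {x : MartindaleQuotient R} (hx : x ∉ ExtendedCentroid R)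
    (hxK : x ∈ Set.centralizer (of R '' (K : Set R))) :
    Module.rank (ExtendedCentroid R) (mulExtendedCentroid (K : Set R)) = 2 :=
  le_antisymm ((Submodule.rank_mono (hK.mulExtendedCentroid_le_span_pair_one hx hxK)).trans
    (rank_span_pair_le x 1)) (hK.two_le_rank hnc)

theorem mulExtendedCentroid_eq_span_pair_one {x : MartindaleQuotient R}
    (hx : x ∉ ExtendedCentroid R) (hxK : x ∈ Set.centralizer (of R '' (K : Set R))) :
    mulExtendedCentroid (K : Set R) = Submodule.span (ExtendedCentroid R) {x, 1} := by
  have : FiniteDimensional (ExtendedCentroid R) (Submodule.span (ExtendedCentroid R) {x, 1}) :=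
    FiniteDimensional.span_of_finite _ (Set.toFinite _)
  refine Submodule.eq_of_le_of_finrank_le (hK.mulExtendedCentroid_le_span_pair_one hx hxK) ?_
  rw [Module.finrank_eq_of_rank_eq (hK.rank_eq_two_of_mem_centralizer hnc hx hxK)]
  exact Module.finrank_le_of_rank_le (rank_span_pair_le x 1)

theorem centralizer_eq_mulExtendedCentroid
    (hrank : Module.rank (ExtendedCentroid R) (mulExtendedCentroid (K : Set R)) = 2) :
    Set.centralizer (of R '' (K : Set R)) = mulExtendedCentroid (K : Set R) := by
  have hKC := mulExtendedCentroid_subset_centralizer (hK.subset_centralizer_of_rank_le_two hrank.le)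
  refine Set.Subset.antisymm (fun x hxK => ?_) hKC
  by_cases hx : x ∈ ExtendedCentroid R
  · obtain ⟨a, ha, hac⟩ := Set.not_subset.mp hnc
    rw [SetLike.mem_coe, hK.mulExtendedCentroid_eq_span_pair_one hnc
      (mt of_mem_extendedCentroid_iff.mp hac) (hKC (of_mem_mulExtendedCentroid ha))]
    exact Submodule.mem_span_pair.mpr ⟨0, ⟨x, hx⟩, by simp [Subring.smul_def]⟩
  · rw [SetLike.mem_coe, hK.mulExtendedCentroid_eq_span_pair_one hnc hx hxK]
    exact Submodule.subset_span (Set.mem_insert _ _)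

theorem inter_centralizer_eq_mulExtendedCentroid_iff {S : Set (MartindaleQuotient R)}
    (hS : (mulExtendedCentroid (K : Set R) : Set (MartindaleQuotient R)) ⊆ S) :
    S ∩ Set.centralizer (of R '' (K : Set R)) = mulExtendedCentroid (K : Set R) ↔
      Module.rank (ExtendedCentroid R) (mulExtendedCentroid (K : Set R)) = 2 := by
  refine ⟨fun h => ?_, fun hrank => ?_⟩
  · obtain ⟨a, ha, hac⟩ := Set.not_subset.mp hnc
    have haK : of R a ∈ S ∩ Set.centralizer (of R '' (K : Set R)) :=
      h ▸ of_mem_mulExtendedCentroid ha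
    exact hK.rank_eq_two_of_mem_centralizer hnc (mt of_mem_extendedCentroid_iff.mp hac) haK.2
  · rw [hK.centralizer_eq_mulExtendedCentroid hnc hrank, Set.inter_eq_right.mpr hS]

theorem centralizer_eq_center_iff :
    Set.centralizer (K : Set R) = Set.center R ↔
      2 < Module.rank (ExtendedCentroid R) (mulExtendedCentroid (K : Set R)) := by
  refine ⟨fun h => ?_, fun hrank => Set.Subset.antisymm (fun x hxK => ?_)
    (Set.center_subset_centralizer _)⟩
  · by_contra! hrank
    exact hnc (h ▸ hK.subset_centralizer_of_rank_le_two hrank)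
  · by_contra hx
    have hxKC : of R x ∈ Set.centralizer (of R '' (K : Set R)) := by
      rintro _ ⟨a, ha, rfl⟩
      rw [← map_mul, ← map_mul, hxK a ha]
    exact hrank.ne' (hK.rank_eq_two_of_mem_centralizer hnc
      (mt of_mem_extendedCentroid_iff.mp hx) hxKC)

end Noncentral

end IsLieIdeal

/-- Here `mulExtendedCentroid Set.univ` is the central closure `RC`, and elements of `R` are viewed
in `RC` through the canonical embedding `R → Q_s(R)`. -/
theorem mainTheorem9 {R : Type u} [NonUnitalRing R] [IsPrimeRing R] (K : AddSubgroup R)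
    (hK : IsLieIdeal K) (hnc : ¬ (K : Set R) ⊆ Set.center R) :
    ((mulExtendedCentroid (Set.univ : Set R) : Set (MartindaleQuotient R)) ∩
          Set.centralizer (MartindaleQuotient.of R '' (K : Set R)) =
        (mulExtendedCentroid (K : Set R) : Set (MartindaleQuotient R)) ↔
      Module.rank (ExtendedCentroid R) (mulExtendedCentroid (K : Set R)) = 2) ∧
    (Set.centralizer (K : Set R) = Set.center R ↔
      2 < Module.rank (ExtendedCentroid R) (mulExtendedCentroid (K : Set R))) := by
  have hKR : mulExtendedCentroid (K : Set R) ≤ mulExtendedCentroid Set.univ :=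
    Submodule.span_mono (Set.image_mono (Set.subset_univ _))
  exact ⟨hK.inter_centralizer_eq_mulExtendedCentroid_iff hnc hKR, hK.centralizer_eq_center_iff hnc⟩
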